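/- Let $V$ be a vector space of finite dimension $\ell$ over an arbitrary field $K$, and let $\Delta=(\alpha_1,\dots,\alpha_n)$ be a finite sequence of linear forms spanning $V^*$ (zero forms and repetitions are allowed). Let $M(\Delta)$ be the matroid on $E=\{1,\dots,n\}$ in which $S\subseteq E$ is independent iff the family $(\alpha_i)_{i\in S}$ is linearly independent, let $r(S)=\dim\operatorname{span}\{\alpha_i:i\in S\}$ be its rank function, and let $$T(\Delta;x,y)=\sum_{S\subseteq E}(x-1)^{\ell-r(S)}(y-1)^{|S|-r(S)}$$ be its Tutte polynomial. For $S\subseteq E$ put $\alpha_S=\prod_{i\in S}\alpha_i\in\operatorname{Sym}(V^*)$. For a flat $X$ of $M(\Delta)$ let $P(\Delta)_X$ be the $K$-span of the $\alpha_S$ such that $E\setminus S$ has closure $X$, and let $P(\Delta)_{X,k}$ be its homogeneous part of degree $n-k$, that is, $P(\Delta)_{X}\cap\operatorname{Sym}^{n-k}(V^*)$ (zero if $k>n$). For an independent set $I$ let $ex(I)$ be the set of externally active elements, i.e. of those $e\in E$ that are the smallest element of a circuit contained in $I\cup\{e\}$. Then: 1. $P(\Delta)_E$ is the span of the $\alpha_S$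 with $r(E\setminus S)=\ell$, and its Hilbert series is $$\sum_{d\ge 0}\dim\bigl(P(\Delta)_E\cap\operatorname{Sym}^d(V^*)\bigr)\,t^d=t^{\,n-\ell}\,T(\Delta;1,1/t).$$ 2. For every flat $X$ and every integer $k\ge 0$, $\dim P(\Delta)_{X,k}$ is the number of independent sets $I$ of $M(\Delta)$ with closure $X$ such that $|I\cup ex(I)|=k$. -/

import Mathlib

noncomputable section

open Module

/-- The matroid `M(Δ)` on the ground set `Fin n` realized by a finite sequence `α` of vectors of a
`K`-vector space `W`: a set of indices is independent iff the corresponding subfamily is linearly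
independent. -/
def linMatroid {K W : Type*} [Field K] [AddCommGroup W] [Module K W] {n : ℕ}
    (α : Fin n → W) : Matroid (Fin n) :=
  (IndepMatroid.ofFinite (E := Set.univ) Set.finite_univ
    (fun S => LinearIndepOn K α S)
    (linearIndepOn_empty K α)
    (fun _ _ hJ hIJ => hJ.mono hIJ)
    (by
      intro I J hI hJ hlt
      by_contra! hcon
      have hsub : α '' J ⊆ Submodule.span K (α '' I) := by
        rintro _ ⟨e, heJ, rfl⟩
        by_cases heI : e ∈ I
        · exact Submodule.subset_span ⟨e, heI, rfl⟩
        · by_contra hspan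
          exact hcon e heJ heI (hI.insert hspan)
      have hle : Submodule.span K (α '' J) ≤ Submodule.span K (α '' I) :=
        Submodule.span_le.2 hsub
      have hfin : FiniteDimensional K (Submodule.span K (α '' I)) :=
        FiniteDimensional.span_of_finite K (Set.toFinite _)
      have h1 := Submodule.finrank_mono hle
      have key : ∀ S : Set (Fin n), LinearIndepOn K α S →
          finrank K (Submodule.span K (α '' S)) = S.ncard := by
        intro S hS
        classical
        have := finrank_span_eq_card hS
        rw [Set.image_eq_range, this, ← Nat.card_eq_fintype_card, Nat.card_coe_set_eq]
      rw [key I hI, key J hJ] at h1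
      omega)
    (fun _ _ => Set.subset_univ _)).matroid

theorem linMatroid_indep_iff {K W : Type*} [Field K] [AddCommGroup W] [Module K W] {n : ℕ}
    (α : Fin n → W) (S : Set (Fin n)) :
    (linMatroid (K := K) α).Indep S ↔ LinearIndepOn K α S := Iff.rfl

open Classical in
/-- The Tutte polynomial `T(M; x, y)` of a matroid on a finite type (`x = X 0`, `y = X 1`), by its
corank-nullity expansion `∑_{S ⊆ E} (x - 1) ^ (r(E) - r(S)) * (y - 1) ^ (|S| - r(S))`. -/
def tuttePoly {β : Type*} [Fintype β] (M : Matroid β) : MvPolynomial (Fin 2) ℤ :=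
  ∑ S ∈ Finset.univ.filter (fun S : Finset β => (S : Set β) ⊆ M.E),
    (MvPolynomial.X 0 - 1) ^ (M.eRank.toNat - (M.eRk S).toNat) *
      (MvPolynomial.X 1 - 1) ^ (S.card - (M.eRk S).toNat)

/-- The set `ex(I)` of externally active elements: those `e` that are the smallest element of some
circuit contained in `I ∪ {e}`. -/
def extActive {β : Type*} [LinearOrder β] (M : Matroid β) (I : Set β) : Set β :=
  {e | ∃ C, M.IsCircuit C ∧ C ⊆ insert e I ∧ IsLeast C e}

section Sym

variable {K V : Type*} [Field K] [AddCommGroup V] [Module K V] {n : ℕ}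

/-- The product `α_S = ∏_{i ∈ S} α_i` in `Sym(V^*)`. -/
def formProd (α : Fin n → Dual K V) (S : Finset (Fin n)) : SymmetricAlgebra K (Dual K V) :=
  ∏ i ∈ S, SymmetricAlgebra.ι K (Dual K V) (α i)

/-- The rank `r(S)`: the dimension of the span of `{α_i : i ∈ S}`. -/
def spanRank (α : Fin n → Dual K V) (S : Set (Fin n)) : ℕ :=
  finrank K (Submodule.span K (α '' S))

variable (K V) in
/-- The homogeneous piece `Sym^d(V^*)`, the span of all `d`-fold products of linear forms. -/
def symPiece (d : ℕ) : Submodule K (SymmetricAlgebra K (Dual K V)) :=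
  LinearMap.range (SymmetricAlgebra.ι K (Dual K V)) ^ d

/-- The Hilbert series `∑_d dim(P ∩ Sym^d(V^*)) t^d` of a subspace `P` of `Sym(V^*)`. -/
def hilbertSeries (P : Submodule K (SymmetricAlgebra K (Dual K V))) : PowerSeries ℤ :=
  PowerSeries.mk fun d => (finrank K ↥(P ⊓ symPiece K V d) : ℤ)

/-- The space `P(Δ)_X`, spanned by the `α_S` such that `E - S` has closure `X`. -/
def flatSpace (α : Fin n → Dual K V) (X : Set (Fin n)) :
    Submodule K (SymmetricAlgebra K (Dual K V)) :=
  Submodule.span K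
    {p | ∃ S : Finset (Fin n), (linMatroid (K := K) α).closure (S : Set (Fin n))ᶜ = X ∧
      p = formProd α S}

/-- The space `P(Δ)_{X,k}`: the part of `P(Δ)_X` of degree `n - k` (zero if `k > n`). -/
def flatPiece (α : Fin n → Dual K V) (X : Set (Fin n)) (k : ℕ) :
    Submodule K (SymmetricAlgebra K (Dual K V)) :=
  if k ≤ n then flatSpace α X ⊓ symPiece K V (n - k) else ⊥

end Sym

end

noncomputable section

open Module

/-! For independent `I` let p(I) be the complement of `I ∪ ex(I)`. The products α_{p(I)}, over
independent `I` with closure `X`, form a homogeneous basis of P(Δ)_X; counting them by degree gives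
part 2.

Independence (`coeff_eq_zero_of_sum_passiveComplement_eq_zero`) is deletion-contraction on the
largest element `a`: terms with `a ∉ I` are divisible by α_a, so passing to Sym(W/⟨α_a⟩) isolates
the terms with `a ∈ I`. Spanning (`formProd_mem_span_passiveComplement`) is a straightening
argument: a factor α_e with `e` externally active is rewritten through later basis elements.

For part 1, each spanning set `S` is sent to its greedy basis taken from the largest element down.
By `lastBasis_eq_iff` the fibre over `B` is the interval from `B` to `B ∪ ex(B)`, so T(1, y) = ∑_B
y^{|ex(B)|}, which matches the degrees n - ℓ - |ex(B)| of the basis. -/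

theorem linearIndepOn_insert_iff_quotient {K W ι : Type*} [Field K] [AddCommGroup W] [Module K W] (α : ι → W)
    {I : Set ι} {a : ι} (haI : a ∉ I) (ha : α a ≠ 0) :
    LinearIndepOn K α (insert a I) ↔
      LinearIndepOn K ((Submodule.span K {α a}).mkQ ∘ α) I := by
  have h := (LinearIndepOn.singleton (R := K) (v := α) ha).quotient_iff_union (t := I)
    (Set.disjoint_singleton_left.2 haI)
  rw [Set.image_singleton] at h
  rw [Set.insert_eq, ← h]

/-- Every functional on `W` extends to an algebra map Sym(W) → K, and functionals separate points.
-/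
theorem eq_zero_of_symmetricAlgebra_ι_eq_zero {K W : Type*} [Field K] [AddCommGroup W] [Module K W] {w : W}
    (h : SymmetricAlgebra.ι K W w = 0) : w = 0 := by
  refine (Module.forall_dual_apply_eq_zero_iff K w).1 fun f => ?_
  rw [← SymmetricAlgebra.lift_ι_apply f w, h, map_zero]

/-! ### Linear independence of the products, by deletion and contraction -/

section PassiveComplement

variable {K : Type*} [Field K] {ι : Type*} [LinearOrder ι]

open Classical in
/-- The elements of `s` outside `I` whose vector is not spanned by the vectors of the later elements
of `I`. For independent `I` it is the complement in `s` of `I ∪ ex(I)`. -/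
def passiveComplement {W : Type*} [AddCommGroup W] [Module K W] (α : ι → W)
    (s I : Finset ι) : Finset ι :=
  {e ∈ s | e ∉ I ∧ α e ∉ Submodule.span K (α '' {f | f ∈ I ∧ e < f})}

theorem mem_passiveComplement {W : Type*} [AddCommGroup W] [Module K W] {α : ι → W}
    {s I : Finset ι} {e : ι} : e ∈ passiveComplement (K := K) α s I ↔
      e ∈ s ∧ e ∉ I ∧ α e ∉ Submodule.span K (α '' {f | f ∈ I ∧ e < f}) := by
  simp [passiveComplement]

theorem passiveComplement_subset {W : Type*} [AddCommGroup W] [Module K W] (α : ι → W)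
    (s I : Finset ι) : passiveComplement (K := K) α s I ⊆ s :=
  fun _ he => (mem_passiveComplement.1 he).1

open Classical in
theorem passiveComplement_insert_of_lt {W : Type*} [AddCommGroup W] [Module K W] (α : ι → W)
    {s I : Finset ι} {a : ι} (has : ∀ x ∈ s, x < a) (hI : I ⊆ s) :
    passiveComplement (K := K) α (insert a s) I =
      if α a = 0 then passiveComplement (K := K) α s I
      else insert a (passiveComplement (K := K) α s I) := by
  have hempty : {f | f ∈ I ∧ a < f} = (∅ : Set ι) := by
    ext f
    simp only [Set.mem_ofPred_eq, Set.mem_empty_iff_false, iff_false, not_and, not_lt]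
    exact fun hf => (has f (hI hf)).le
  have haI : a ∉ I := fun h => lt_irrefl a (has a (hI h))
  unfold passiveComplement
  rw [Finset.filter_insert, hempty]
  by_cases h : α a = 0 <;> simp [h, haI]

open Classical in
-- Contraction step: `a` is later than every `e ∈ s`, so α_a always lies in the span being tested
-- and can be factored out.
theorem passiveComplement_insert_insert {W : Type*} [AddCommGroup W] [Module K W] (α : ι → W)
    {s I : Finset ι} {a : ι} (has : ∀ x ∈ s, x < a) :
    passiveComplement (K := K) α (insert a s) (insert a I) =
      passiveComplement (K := K) ((Submodule.span K {α a}).mkQ ∘ α) s I := by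
  ext e
  simp only [passiveComplement, Finset.mem_filter, Finset.mem_insert, not_or]
  have key (he : e < a) :
      α e ∈ Submodule.span K (α '' {f | (f = a ∨ f ∈ I) ∧ e < f}) ↔
        ((Submodule.span K {α a}).mkQ ∘ α) e ∈ Submodule.span K
          (((Submodule.span K {α a}).mkQ ∘ α) '' {f | f ∈ I ∧ e < f}) := by
    have h1 : {f | (f = a ∨ f ∈ I) ∧ e < f} = insert a {f | f ∈ I ∧ e < f} := by
      ext f
      simp only [Set.mem_ofPred_eq, Set.mem_insert_iff]
      constructor
      · rintro ⟨rfl | h, h'⟩ <;> simp_all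
      · rintro (rfl | h) <;> simp_all
    rw [h1, Set.image_insert_eq, Set.image_comp, ← Submodule.map_span, Function.comp_apply,
      ← Submodule.mem_comap, Submodule.comap_map_mkQ, Submodule.span_insert]
  constructor
  · rintro ⟨h | h, ⟨h1, h2⟩, h3⟩
    · exact absurd h h1
    · exact ⟨h, h2, fun h' => h3 ((key (has e h)).2 h')⟩
  · rintro ⟨h, h2, h3⟩
    exact ⟨Or.inr h, ⟨(has e h).ne, h2⟩, fun h' => h3 ((key (has e h)).1 h')⟩

open Classical in
-- The space, the vectors and the coefficients all vary in the induction, because contraction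
-- replaces `W` by a quotient.
theorem coeff_eq_zero_of_sum_passiveComplement_eq_zero.{u} (s : Finset ι) :
    ∀ {W : Type u} [AddCommGroup W] [Module K W] (α : ι → W) (c : Finset ι → K),
      (∑ I ∈ s.powerset, if LinearIndepOn K α (I : Set ι) then
        c I • ∏ i ∈ passiveComplement (K := K) α s I, SymmetricAlgebra.ι K W (α i) else 0) = 0 →
      ∀ I ⊆ s, LinearIndepOn K α (I : Set ι) → c I = 0 := by
  induction s using Finset.induction_on_max with
  | empty =>
    intro W _ _ α c h I hI hind
    obtain rfl := Finset.subset_empty.1 hI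
    simpa [passiveComplement] using h
  | insert a s has ih =>
    intro W _ _ α c h I hI hind
    have ha : a ∉ s := fun h => lt_irrefl a (has a h)
    rw [Finset.sum_powerset_insert ha] at h
    by_cases h0 : α a = 0
    · have hna (J : Finset ι) : ¬ LinearIndepOn K α ((insert a J : Finset ι) : Set ι) := by
        intro hJ
        exact hJ.ne_zero (Finset.mem_coe.2 (Finset.mem_insert_self a J)) h0
      have haI : a ∉ I := fun haI => hind.ne_zero (Finset.mem_coe.2 haI) h0
      refine ih α c ?_ I ((Finset.subset_insert_iff_of_notMem haI).1 hI) hind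
      rw [Finset.sum_eq_zero (fun J _ => if_neg (hna J)), add_zero] at h
      refine (Finset.sum_congr rfl fun J hJ => ?_).trans h
      rw [passiveComplement_insert_of_lt α has (Finset.mem_powerset.1 hJ), if_pos h0]
    -- No element is later than `a`, so a nonzero α_a is a factor of every term with `a ∉ J`.
    · have hout : ∀ J ∈ s.powerset,
          (if LinearIndepOn K α (J : Set ι) then c J • ∏ i ∈ passiveComplement (K := K) α
            (insert a s) J, SymmetricAlgebra.ι K W (α i) else 0) =
          SymmetricAlgebra.ι K W (α a) * (if LinearIndepOn K α (J : Set ι) then c J •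
            ∏ i ∈ passiveComplement (K := K) α s J, SymmetricAlgebra.ι K W (α i) else 0) := by
        intro J hJ
        rw [passiveComplement_insert_of_lt α has (Finset.mem_powerset.1 hJ), if_neg h0,
          Finset.prod_insert (fun h => ha (passiveComplement_subset α s J h))]
        split_ifs <;> simp
      rw [Finset.sum_congr rfl hout, ← Finset.mul_sum] at h
      set q := (Submodule.span K {α a}).mkQ with hq
      let φ : SymmetricAlgebra K W →ₐ[K] SymmetricAlgebra K (W ⧸ Submodule.span K {α a}) :=
        SymmetricAlgebra.lift (SymmetricAlgebra.ι K _ ∘ₗ q)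
      have hφ (w : W) : φ (SymmetricAlgebra.ι K W w) = SymmetricAlgebra.ι K _ (q w) :=
        SymmetricAlgebra.lift_ι_apply _ _
      have hqa : q (α a) = 0 := by simp [hq]
      -- `φ` kills the multiples of α_a, leaving a relation of the same shape for the contraction.
      have hin : ∀ J ⊆ s, LinearIndepOn K α ((insert a J : Finset ι) : Set ι) →
          c (insert a J) = 0 := by
        intro J hJ hJind
        refine ih (q ∘ α) (fun J => c (insert a J)) ?_ J hJ ?_
        · have h2 := congrArg φ h
          rw [map_add, map_mul, hφ, hqa, map_zero, zero_mul, zero_add, map_zero, map_sum] at h2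
          refine (Finset.sum_congr rfl fun L hL => ?_).trans h2
          have haL : a ∉ (L : Set ι) := fun h => ha (Finset.mem_powerset.1 hL h)
          rw [Finset.coe_insert, linearIndepOn_insert_iff_quotient α haL h0,
            passiveComplement_insert_insert α has]
          split_ifs
          · simp [map_prod, hφ, hq]
          · simp
        · rw [Finset.coe_insert, linearIndepOn_insert_iff_quotient α (fun h => ha (hJ h)) h0] at hJind
          exact hJind
      by_cases haI : a ∈ I
      · have := hin (I.erase a) (Finset.subset_insert_iff.1 hI) ?_
        · rwa [Finset.insert_erase haI] at this
        · rwa [Finset.insert_erase haI]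
      · have hz : ∀ J ∈ s.powerset, (if LinearIndepOn K α ((insert a J : Finset ι) : Set ι) then
            c (insert a J) • ∏ i ∈ passiveComplement (K := K) α (insert a s) (insert a J),
              SymmetricAlgebra.ι K W (α i) else 0) = 0 := by
          intro J hJ
          split_ifs with hJ'
          · rw [hin J (Finset.mem_powerset.1 hJ) hJ', zero_smul]
          · rfl
        rw [Finset.sum_eq_zero hz, add_zero] at h
        refine ih α c ?_ I ((Finset.subset_insert_iff_of_notMem haI).1 hI) hind
        -- The symmetric algebra is a domain, so α_a cancels and the relation for the deletion
        -- remains.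
        exact (mul_eq_zero.1 h).resolve_left fun h' =>
          h0 (eq_zero_of_symmetricAlgebra_ι_eq_zero h')

end PassiveComplement

/-! ### The greedy basis from the top, and its fibres -/

section LastBasis

variable {K W ι : Type*} [Field K] [AddCommGroup W] [Module K W] [LinearOrder ι]

open Classical in
/-- The basis of `T` selected greedily from the largest element downwards. -/
def lastBasis (K : Type*) {W ι : Type*} [Field K] [AddCommGroup W] [Module K W] [LinearOrder ι]
    (α : ι → W) (T : Finset ι) : Finset ι :=
  {e ∈ T | α e ∉ Submodule.span K (α '' {f | f ∈ T ∧ e < f})}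

theorem mem_lastBasis {α : ι → W} {T : Finset ι} {e : ι} : e ∈ lastBasis K α T ↔
    e ∈ T ∧ α e ∉ Submodule.span K (α '' {f | f ∈ T ∧ e < f}) := by
  simp [lastBasis]

theorem lastBasis_subset (α : ι → W) (T : Finset ι) : lastBasis K α T ⊆ T :=
  fun _ he => (mem_lastBasis.1 he).1

theorem span_image_lt_mono (α : ι → W) {S T : Finset ι} (h : S ⊆ T) (e : ι) :
    Submodule.span K (α '' {f | f ∈ S ∧ e < f}) ≤ Submodule.span K (α '' {f | f ∈ T ∧ e < f}) :=
  Submodule.span_mono (Set.image_mono fun _ hf => ⟨h hf.1, hf.2⟩)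

/-- Induction from the largest element down: a vector outside `B` is spanned by later ones, and
these stay in the upper set `U`. -/
theorem span_inter_eq_of_forall_mem_span [Finite ι] {α : ι → W} {B T : Finset ι} (hBT : B ⊆ T)
    (h : ∀ g ∈ T, g ∉ B → α g ∈ Submodule.span K (α '' {f | f ∈ T ∧ g < f}))
    {U : Set ι} (hU : IsUpperSet U) :
    Submodule.span K (α '' {f | f ∈ B ∧ f ∈ U}) = Submodule.span K (α '' {f | f ∈ T ∧ f ∈ U}) := by
  refine le_antisymm (Submodule.span_mono (Set.image_mono fun f hf => ⟨hBT hf.1, hf.2⟩)) ?_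
  rw [Submodule.span_le]
  rintro _ ⟨g, ⟨hgT, hgU⟩, rfl⟩
  induction g using WellFoundedGT.induction with
  | ind g ih =>
    by_cases hgB : g ∈ B
    · exact Submodule.subset_span ⟨g, ⟨hgB, hgU⟩, rfl⟩
    · refine (Submodule.span_le.2 ?_) (h g hgT hgB)
      rintro _ ⟨f, ⟨hfT, hgf⟩, rfl⟩
      exact ih f hgf hfT (hU hgf.le hgU)

theorem span_eq_of_forall_mem_span [Finite ι] {α : ι → W} {B T : Finset ι} (hBT : B ⊆ T)
    (h : ∀ g ∈ T, g ∉ B → α g ∈ Submodule.span K (α '' {f | f ∈ T ∧ g < f})) :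
    Submodule.span K (α '' (B : Set ι)) = Submodule.span K (α '' (T : Set ι)) := by
  simpa using! span_inter_eq_of_forall_mem_span hBT h isUpperSet_univ

theorem forall_mem_span_of_notMem_lastBasis {α : ι → W} {T : Finset ι} :
    ∀ g ∈ T, g ∉ lastBasis K α T → α g ∈ Submodule.span K (α '' {f | f ∈ T ∧ g < f}) := by
  intro g hgT hg
  by_contra h
  exact hg (mem_lastBasis.2 ⟨hgT, h⟩)

theorem span_lastBasis [Finite ι] (α : ι → W) (T : Finset ι) :
    Submodule.span K (α '' (lastBasis K α T : Set ι)) = Submodule.span K (α '' (T : Set ι)) :=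
  span_eq_of_forall_mem_span (lastBasis_subset α T) forall_mem_span_of_notMem_lastBasis

theorem linearIndepOn_of_notMem_span_lt {α : ι → W} (B : Finset ι)
    (h : ∀ e ∈ B, α e ∉ Submodule.span K (α '' {f | f ∈ B ∧ e < f})) :
    LinearIndepOn K α (B : Set ι) := by
  induction B using Finset.induction_on_min with
  | empty => simp
  | insert a s has ih =>
    rw [Finset.coe_insert]
    refine LinearIndepOn.insert (ih fun e he hes => ?_) ?_
    · exact h e (Finset.mem_insert_of_mem he) 
        (span_image_lt_mono α (Finset.subset_insert a s) e hes)
    · intro hes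
      have hsub : (s : Set ι) ⊆ {f | f ∈ insert a s ∧ a < f} :=
        fun f hf => ⟨Finset.mem_insert_of_mem hf, has f hf⟩
      exact h a (Finset.mem_insert_self a s) (Submodule.span_mono (Set.image_mono hsub) hes)

theorem linearIndepOn_lastBasis (α : ι → W) (T : Finset ι) :
    LinearIndepOn K α (lastBasis K α T : Set ι) := by
  refine linearIndepOn_of_notMem_span_lt _ fun e he hes => (mem_lastBasis.1 he).2 ?_
  exact span_image_lt_mono α (lastBasis_subset α T) e hes

theorem notMem_span_lt_of_linearIndepOn {α : ι → W} {I : Finset ι}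
    (hI : LinearIndepOn K α (I : Set ι)) {e : ι} (he : e ∈ I) :
    α e ∉ Submodule.span K (α '' {f | f ∈ I ∧ e < f}) := by
  intro h
  refine (linearIndepOn_iff_notMem_span.1 hI) e he (Submodule.span_mono (Set.image_mono ?_) h)
  exact fun f hf => ⟨hf.1, hf.2.ne'⟩

/-- Adding externally active elements to `I` leaves the span of the elements later than any `e`
unchanged, so the greedy choice does not notice them. -/
theorem lastBasis_eq_iff [Fintype ι] {α : ι → W} {I T : Finset ι}
    (hI : LinearIndepOn K α (I : Set ι)) :
    lastBasis K α T = I ↔ I ⊆ T ∧ Disjoint T (passiveComplement (K := K) α Finset.univ I) := by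
  have hU (e : ι) : IsUpperSet {f | e < f} := fun a b hab ha => lt_of_lt_of_le ha hab
  simp only [Finset.disjoint_left, mem_passiveComplement, Finset.mem_univ, true_and, not_and,
    not_not]
  constructor
  · rintro rfl
    refine ⟨lastBasis_subset α T, fun e heT heI => ?_⟩
    have := span_inter_eq_of_forall_mem_span (lastBasis_subset (K := K) α T)
      forall_mem_span_of_notMem_lastBasis (hU e)
    exact this.symm ▸ forall_mem_span_of_notMem_lastBasis e heT heI
  · rintro ⟨hIT, hT⟩
    have hspan (e : ι) := span_inter_eq_of_forall_mem_span (K := K) (α := α) hIT (fun g hg hgI =>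
      span_image_lt_mono α hIT g (hT hg hgI)) (hU e)
    ext e
    have he : α e ∈ Submodule.span K (α '' {f | f ∈ T ∧ e < f}) ↔
        α e ∈ Submodule.span K (α '' {f | f ∈ I ∧ e < f}) := by
      have := hspan e
      simp only [Set.mem_ofPred_eq] at this
      rw [this]
    rw [mem_lastBasis, he]
    constructor
    · rintro ⟨h1, h2⟩
      by_contra h3
      exact h2 (hT h1 h3)
    · exact fun h => ⟨hIT h, notMem_span_lt_of_linearIndepOn hI h⟩

theorem span_compl_passiveComplement [Fintype ι] (α : ι → W) (I : Finset ι) :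
    Submodule.span K (α '' ((passiveComplement (K := K) α Finset.univ I : Set ι)ᶜ)) =
      Submodule.span K (α '' (I : Set ι)) := by
  refine le_antisymm ?_ (Submodule.span_mono (Set.image_mono fun e he h => ?_))
  · rw [Submodule.span_le]
    rintro _ ⟨e, he, rfl⟩
    simp only [Set.mem_compl_iff, Finset.mem_coe, mem_passiveComplement, Finset.mem_univ, true_and,
      not_and, not_not] at he
    by_cases heI : e ∈ I
    · exact Submodule.subset_span ⟨e, heI, rfl⟩
    · exact Submodule.span_mono (Set.image_mono fun f hf => hf.1) (he heI)
  · exact (mem_passiveComplement.1 h).2.1 he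

theorem span_insert_sdiff_singleton_eq {α : ι → W} {T : Set ι} {B : Finset ι} (hB : ↑B ⊆ T) {e f : ι}
    {c : ι → K} (hc : ∑ g ∈ B, c g • α g = α e) (he : e ∉ T) (hf : f ∈ B) (hcf : c f ≠ 0) :
    Submodule.span K (α '' (insert e T \ {f})) = Submodule.span K (α '' T) := by
  have heB : α e ∈ Submodule.span K (α '' T) := by
    rw [← hc]
    exact Submodule.sum_mem _ fun g hg => Submodule.smul_mem _ _ (Submodule.subset_span ⟨g, hB hg, rfl⟩)
  have hef : e ≠ f := fun h => he (h ▸ hB hf)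
  refine le_antisymm ?_ ?_ <;> rw [Submodule.span_le]
  · rintro _ ⟨g, ⟨rfl | hg, -⟩, rfl⟩
    · exact heB
    · exact Submodule.subset_span ⟨g, hg, rfl⟩
  · have hmem : ∀ g ∈ T, g ≠ f → α g ∈ Submodule.span K (α '' (insert e T \ {f})) :=
      fun g hg hgf => Submodule.subset_span ⟨g, ⟨Or.inr hg, hgf⟩, rfl⟩
    rintro _ ⟨g, hg, rfl⟩
    by_cases hgf : g = f
    · subst hgf
      rw [← Finset.add_sum_erase B _ hf] at hc
      have : α g = (c g)⁻¹ • (α e - ∑ x ∈ B.erase g, c x • α x) := by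
        rw [← hc, add_sub_cancel_right, smul_smul, inv_mul_cancel₀ hcf, one_smul]
      rw [SetLike.mem_coe, this]
      refine Submodule.smul_mem _ _ (Submodule.sub_mem _ ?_ (Submodule.sum_mem _ fun x hx => ?_))
      · exact Submodule.subset_span ⟨e, ⟨Or.inl rfl, hef⟩, rfl⟩
      · exact Submodule.smul_mem _ _ (hmem x (hB (Finset.mem_of_mem_erase hx))
          (Finset.ne_of_mem_erase hx))
    · exact hmem g hg hgf

end LastBasis

/-! ### Straightening: the products span -/

section Straightening

variable {K V : Type*} [Field K] [AddCommGroup V] [Module K V] {n : ℕ}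

theorem formProd_mem_span_passiveComplement (α : Fin n → Dual K V) (S : Finset (Fin n)) :
    formProd α S ∈ Submodule.span K
      ((fun I => formProd α (passiveComplement (K := K) α Finset.univ I)) ''
        {I : Finset (Fin n) | LinearIndepOn K α (I : Set (Fin n)) ∧
          Submodule.span K (α '' (I : Set (Fin n))) =
            Submodule.span K (α '' (S : Set (Fin n))ᶜ)}) := by
  -- Each exchange puts `e` into the complement of `S` in place of a later `f`, which lowers this
  -- sum of indices.
  induction hN : ∑ e ∈ Sᶜ, (e : ℕ) using Nat.strong_induction_on generalizing S with
  | _ N ih =>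
    set B := lastBasis K α Sᶜ with hBdef
    have hBind := linearIndepOn_lastBasis (K := K) α Sᶜ
    have hBspan := span_lastBasis (K := K) α Sᶜ
    have hB := (lastBasis_eq_iff (T := Sᶜ) hBind).1 rfl
    rw [← hBdef] at hBind hBspan hB
    rw [Finset.coe_compl] at hBspan
    have hsub : passiveComplement (K := K) α Finset.univ B ⊆ S := by
      intro e he
      by_contra h
      exact Finset.disjoint_left.1 hB.2 (Finset.mem_compl.2 h) he
    by_cases hS : S ⊆ passiveComplement (K := K) α Finset.univ B
    · refine Submodule.subset_span ⟨B, ⟨hBind, hBspan⟩, ?_⟩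
      exact congrArg (formProd α) (hsub.antisymm hS)
    obtain ⟨e, heS, he⟩ := Finset.not_subset.1 hS
    have heB : e ∉ B := fun h => Finset.mem_compl.1 (hB.1 h) heS
    have hspan : α e ∈ Submodule.span K (α '' ({f ∈ B | e < f} : Finset (Fin n))) := by
      by_contra h
      exact he (mem_passiveComplement.2 ⟨Finset.mem_univ e, heB, by simpa using h⟩)
    obtain ⟨c, hcsupp, hc⟩ := (Finsupp.mem_span_image_iff_linearCombination K).1 hspan
    rw [Finsupp.linearCombination_apply_of_mem_supported K hcsupp] at hc
    -- Each `f` lies in `B`, hence outside `S`, so no factor is repeated.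
    have hprod : formProd α S = ∑ f ∈ B with e < f, c f • formProd α (insert f (S.erase e)) := by
      rw [formProd, ← Finset.mul_prod_erase S _ heS, ← hc, map_sum, Finset.sum_mul]
      refine Finset.sum_congr rfl fun f hf => ?_
      have hfS : f ∉ S.erase e := fun h => Finset.mem_compl.1 (hB.1 (Finset.mem_filter.1 hf).1)
        (Finset.mem_of_mem_erase h)
      rw [formProd, Finset.prod_insert hfS, map_smul, smul_mul_assoc]
    rw [hprod]
    refine Submodule.sum_mem _ fun f hf => ?_
    by_cases hcf : c f = 0
    · rw [hcf, zero_smul]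
      exact Submodule.zero_mem _
    refine Submodule.smul_mem _ _ ?_
    have hfB := (Finset.mem_filter.1 hf).1
    have hef := (Finset.mem_filter.1 hf).2
    have hfS : f ∈ Sᶜ := hB.1 hfB
    have hcompl : (insert f (S.erase e))ᶜ = insert e (Sᶜ.erase f) := by
      ext x
      simp only [Finset.mem_compl, Finset.mem_insert, Finset.mem_erase]
      constructor
      · intro h; push Not at h
        by_cases hx : x = e
        · exact Or.inl hx
        · exact Or.inr ⟨h.1, fun h' => absurd h' (h.2 hx)⟩
      · rintro (rfl | ⟨h1, h2⟩)
        · simp [hef.ne]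
        · simp [h1, h2]
    have hlt : ∑ x ∈ (insert f (S.erase e))ᶜ, (x : ℕ) < N := by
      rw [hcompl, Finset.sum_insert (by simp [heS]), ← hN, ← Finset.add_sum_erase _ _ hfS]
      exact Nat.add_lt_add_right hef _
    -- As `c f ≠ 0`, the relation can be solved for α_f, and the exchange keeps the span of the
    -- complement.
    have hspan' : Submodule.span K (α '' ((insert f (S.erase e) : Finset (Fin n)) : Set (Fin n))ᶜ) =
        Submodule.span K (α '' (S : Set (Fin n))ᶜ) := by
      rw [← Finset.coe_compl, hcompl, ← span_insert_sdiff_singleton_eq (T := (S : Set (Fin n))ᶜ)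
        (B := {f ∈ B | e < f}) ?_ hc (by simpa using heS) hf hcf]
      · congr 2
        ext x
        simp only [Finset.coe_insert, Finset.coe_erase, Finset.coe_compl, Set.mem_insert_iff,
          Set.mem_sdiff, Set.mem_singleton_iff, Set.mem_compl_iff]
        constructor
        · rintro (rfl | ⟨h1, h2⟩)
          · exact ⟨Or.inl rfl, hef.ne⟩
          · exact ⟨Or.inr h1, h2⟩
        · rintro ⟨rfl | h1, h2⟩
          · exact Or.inl rfl
          · exact Or.inr ⟨h1, h2⟩
      · intro x hx
        simpa using hB.1 (Finset.mem_filter.1 hx).1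
    have := ih _ hlt (insert f (S.erase e)) rfl
    rwa [hspan'] at this

end Straightening

/-! ### Closure, rank and external activity in terms of spans -/

section LinMatroid

variable {K W : Type*} [Field K] [AddCommGroup W] [Module K W] {n : ℕ}

theorem linMatroid_ground (α : Fin n → W) : (linMatroid (K := K) α).E = Set.univ := rfl

theorem span_eq_of_isBasis_linMatroid {α : Fin n → W} {I S : Set (Fin n)}
    (h : (linMatroid (K := K) α).IsBasis I S) :
    Submodule.span K (α '' I) = Submodule.span K (α '' S) := by
  refine le_antisymm (Submodule.span_mono (Set.image_mono h.subset)) ?_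
  rw [Submodule.span_le]
  rintro _ ⟨e, he, rfl⟩
  by_contra hspan
  have hI : LinearIndepOn K α I := h.indep
  exact hspan (Submodule.subset_span ⟨e, h.mem_of_insert_indep he (hI.insert hspan), rfl⟩)

theorem mem_closure_linMatroid {α : Fin n → W} {S : Set (Fin n)} {e : Fin n} :
    e ∈ (linMatroid (K := K) α).closure S ↔ α e ∈ Submodule.span K (α '' S) := by
  obtain ⟨I, hI⟩ := (linMatroid (K := K) α).exists_isBasis S (Set.subset_univ _)
  have hind : LinearIndepOn K α I := hI.indep
  rw [← hI.closure_eq_closure, ← span_eq_of_isBasis_linMatroid hI, hI.indep.mem_closure_iff',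
    hind.mem_span_iff]
  exact and_iff_right (Set.mem_univ e)

theorem closure_linMatroid_eq_of_span_eq {α : Fin n → W} {S T : Set (Fin n)}
    (h : Submodule.span K (α '' S) = Submodule.span K (α '' T)) :
    (linMatroid (K := K) α).closure S = (linMatroid (K := K) α).closure T := by
  ext e
  rw [mem_closure_linMatroid, mem_closure_linMatroid, h]

theorem closure_linMatroid_eq_univ_iff {α : Fin n → W} (hα : Submodule.span K (Set.range α) = ⊤)
    {S : Set (Fin n)} :
    (linMatroid (K := K) α).closure S = Set.univ ↔ Submodule.span K (α '' S) = ⊤ := by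
  rw [Set.eq_univ_iff_forall]
  simp only [mem_closure_linMatroid]
  rw [← top_le_iff, ← hα, Submodule.span_le, Set.range_subset_iff]
  rfl

theorem mem_extActive_linMatroid {α : Fin n → W} {I : Set (Fin n)} {e : Fin n} :
    e ∈ extActive (linMatroid (K := K) α) I ↔
      α e ∈ Submodule.span K (α '' {f | f ∈ I ∧ e < f}) := by
  rw [← mem_closure_linMatroid]
  constructor
  · rintro ⟨C, hC, hCI, heC, hle⟩
    refine Matroid.closure_subset_closure _ ?_ (hC.mem_closure_sdiff_singleton_of_mem heC)
    rintro f ⟨hf, hfe⟩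
    exact ⟨(hCI hf).resolve_left hfe, lt_of_le_of_ne (hle hf) (Ne.symm hfe)⟩
  · intro h
    obtain ⟨C, hCI, hC, heC⟩ := (Matroid.mem_closure_iff_exists_isCircuit
      (fun h : e ∈ {f | f ∈ I ∧ e < f} => lt_irrefl e h.2)).1 h
    refine ⟨C, hC, fun f hf => ?_, heC, fun f hf => ?_⟩
    · exact (hCI hf).imp id fun h => h.1
    · rcases hCI hf with rfl | h
      · exact le_rfl
      · exact h.2.le

theorem finrank_span_image_of_linearIndepOn {ι : Type*} [Finite ι] {α : ι → W} {S : Set ι}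
    (hS : LinearIndepOn K α S) : finrank K (Submodule.span K (α '' S)) = S.ncard := by
  have := Fintype.ofFinite S
  rw [Set.image_eq_range, finrank_span_eq_card hS, ← Nat.card_eq_fintype_card,
    Nat.card_coe_set_eq]

theorem eRk_linMatroid_toNat (α : Fin n → W) (S : Set (Fin n)) :
    ((linMatroid (K := K) α).eRk S).toNat = finrank K (Submodule.span K (α '' S)) := by
  obtain ⟨I, hI⟩ := (linMatroid (K := K) α).exists_isBasis S (Set.subset_univ _)
  have hind : LinearIndepOn K α I := hI.indep
  rw [← hI.encard_eq_eRk, ← span_eq_of_isBasis_linMatroid hI,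
    finrank_span_image_of_linearIndepOn hind, Set.ncard]

theorem compl_passiveComplement_eq (α : Fin n → W) (I : Finset (Fin n)) :
    (passiveComplement (K := K) α Finset.univ I : Set (Fin n))ᶜ =
      ↑I ∪ extActive (linMatroid (K := K) α) I := by
  ext e
  simp only [Set.mem_compl_iff, Finset.mem_coe, mem_passiveComplement, Finset.mem_univ, true_and,
    Set.mem_union, mem_extActive_linMatroid]
  tauto

theorem ncard_union_extActive (α : Fin n → W) (I : Finset (Fin n)) :
    ((I : Set (Fin n)) ∪ extActive (linMatroid (K := K) α) I).ncard =
      n - (passiveComplement (K := K) α Finset.univ I).card := by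
  rw [← compl_passiveComplement_eq, ← Finset.coe_compl, Set.ncard_coe_finset, Finset.card_compl,
    Fintype.card_fin]

end LinMatroid

/-! ### The grading of the symmetric algebra -/

section Grading

variable {K V : Type*} [Field K] [AddCommGroup V] [Module K V] {n : ℕ}

theorem equivMvPolynomial_mem_homogeneousSubmodule {κ : Type*} (b : Basis κ K (Dual K V)) {d : ℕ}
    {x : SymmetricAlgebra K (Dual K V)} (hx : x ∈ symPiece K V d) :
    SymmetricAlgebra.equivMvPolynomial b x ∈ MvPolynomial.homogeneousSubmodule κ K d := by
  have hι : ∀ w : Dual K V, SymmetricAlgebra.equivMvPolynomial b (SymmetricAlgebra.ι K _ w) ∈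
      MvPolynomial.homogeneousSubmodule κ K 1 := by
    have h : Submodule.span K (Set.range b) ≤ (MvPolynomial.homogeneousSubmodule κ K 1).comap
        ((SymmetricAlgebra.equivMvPolynomial b).toLinearMap ∘ₗ SymmetricAlgebra.ι K _) := by
      rw [Submodule.span_le]
      rintro _ ⟨i, rfl⟩
      simpa using MvPolynomial.isHomogeneous_X K i
    exact fun w => h (b.mem_span w)
  induction d generalizing x with
  | zero =>
    rw [symPiece, pow_zero] at hx
    obtain ⟨c, rfl⟩ := Submodule.mem_one.1 hx
    rw [AlgEquiv.commutes]
    exact MvPolynomial.isHomogeneous_C κ c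
  | succ d ih =>
    rw [symPiece, pow_succ] at hx
    induction hx using Submodule.mul_induction_on' with
    | mem_mul_mem y hy z hz =>
      obtain ⟨w, rfl⟩ := hz
      rw [map_mul]
      exact MvPolynomial.IsHomogeneous.mul (ih hy) (hι w)
    | add y _ z _ hy hz => rw [map_add]; exact Submodule.add_mem _ hy hz

/-- A basis of the dual identifies the symmetric algebra with polynomials, where the homogeneous
component is the required projection. -/
theorem exists_symPiece_projection (k : ℕ) :
    ∃ π : SymmetricAlgebra K (Dual K V) →ₗ[K] SymmetricAlgebra K (Dual K V),
      ∀ j, ∀ x ∈ symPiece K V j, π x = if j = k then x else 0 := by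
  let e := SymmetricAlgebra.equivMvPolynomial (Basis.ofVectorSpace K (Dual K V))
  refine ⟨e.symm.toLinearMap ∘ₗ MvPolynomial.homogeneousComponent k ∘ₗ e.toLinearMap,
    fun j x hx => ?_⟩
  have h := MvPolynomial.homogeneousComponent_of_mem (m := k)
    (equivMvPolynomial_mem_homogeneousSubmodule (Basis.ofVectorSpace K (Dual K V)) hx)
  simp only [LinearMap.comp_apply, AlgEquiv.toLinearMap_apply]
  rw [h]
  by_cases hjk : j = k
  · rw [if_pos hjk.symm, if_pos hjk]
    exact e.symm_apply_apply x
  · rw [if_neg (Ne.symm hjk), if_neg hjk, map_zero]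

theorem span_image_inf_symPiece {κ : Type*} {s : Set κ}
    {b : κ → SymmetricAlgebra K (Dual K V)} {d : κ → ℕ} (hb : ∀ i, b i ∈ symPiece K V (d i))
    (k : ℕ) :
    Submodule.span K (b '' s) ⊓ symPiece K V k =
      Submodule.span K (b '' {i | i ∈ s ∧ d i = k}) := by
  refine le_antisymm ?_ (le_inf (Submodule.span_mono (Set.image_mono fun i hi => hi.1)) ?_)
  · obtain ⟨π, hπ⟩ := exists_symPiece_projection (K := K) (V := V) k
    rintro x ⟨hx, hxk⟩
    have hπx : π x = x := by simpa using hπ k x hxk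
    rw [← hπx]
    have hmem := Submodule.mem_map_of_mem (f := π) hx
    rw [Submodule.map_span] at hmem
    refine Submodule.span_le.2 ?_ hmem
    rintro _ ⟨_, ⟨i, hi, rfl⟩, rfl⟩
    rw [SetLike.mem_coe, hπ _ _ (hb i)]
    split_ifs with h
    · exact Submodule.subset_span ⟨i, ⟨hi, h⟩, rfl⟩
    · exact Submodule.zero_mem _
  · rw [Submodule.span_le]
    rintro _ ⟨i, ⟨-, rfl⟩, rfl⟩
    exact hb i

theorem formProd_mem_symPiece (α : Fin n → Dual K V) (S : Finset (Fin n)) :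
    formProd α S ∈ symPiece K V S.card := by
  classical
  induction S using Finset.induction_on with
  | empty => simp [symPiece, formProd]
  | insert a s ha ih =>
    rw [symPiece, formProd, Finset.prod_insert ha, Finset.card_insert_of_notMem ha, pow_succ']
    exact Submodule.mul_mem_mul ⟨α a, rfl⟩ ih

end Grading

/-! ### The homogeneous basis of P(Δ)_X and its dimension count -/

section FlatSpace

variable {K V : Type*} [Field K] [AddCommGroup V] [Module K V] {n : ℕ}

theorem linearIndepOn_formProd_passiveComplement (α : Fin n → Dual K V) :
    LinearIndepOn K (fun I => formProd α (passiveComplement (K := K) α Finset.univ I))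
      {I : Finset (Fin n) | LinearIndepOn K α (I : Set (Fin n))} := by
  classical
  rw [linearIndepOn_iff']
  intro t g ht hg I hI
  have h := coeff_eq_zero_of_sum_passiveComplement_eq_zero Finset.univ α
    (fun J => if J ∈ t then g J else 0) ?_ I (Finset.subset_univ I) (ht hI)
  · simpa [hI] using h
  rw [Finset.powerset_univ]
  refine Eq.trans (Eq.symm ?_) hg
  refine Finset.sum_subset_zero_on_sdiff (Finset.subset_univ t) (fun J hJ => ?_) fun J hJ => ?_
  · have hJt : J ∉ t := (Finset.mem_sdiff.1 hJ).2
    simp [hJt]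
  · have hind : LinearIndepOn K α (J : Set (Fin n)) := ht hJ
    simp [hJ, hind, formProd]

theorem flatSpace_eq_span (α : Fin n → Dual K V) (X : Set (Fin n)) :
    flatSpace α X = Submodule.span K
      ((fun I => formProd α (passiveComplement (K := K) α Finset.univ I)) ''
        {I : Finset (Fin n) | LinearIndepOn K α (I : Set (Fin n)) ∧
          (linMatroid (K := K) α).closure I = X}) := by
  refine le_antisymm (Submodule.span_le.2 ?_) (Submodule.span_mono ?_)
  · rintro _ ⟨S, rfl, rfl⟩
    refine Submodule.span_mono (Set.image_mono ?_) (formProd_mem_span_passiveComplement α S)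
    exact fun I hI => ⟨hI.1, closure_linMatroid_eq_of_span_eq hI.2⟩
  · rintro _ ⟨I, ⟨-, rfl⟩, rfl⟩
    exact ⟨_, closure_linMatroid_eq_of_span_eq (span_compl_passiveComplement α I), rfl⟩

theorem finrank_flatSpace_inf_symPiece (α : Fin n → Dual K V) (X : Set (Fin n)) (d : ℕ) :
    finrank K ↥(flatSpace α X ⊓ symPiece K V d) =
      {I : Finset (Fin n) | (LinearIndepOn K α (I : Set (Fin n)) ∧
        (linMatroid (K := K) α).closure I = X) ∧
        (passiveComplement (K := K) α Finset.univ I).card = d}.ncard := by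
  rw [flatSpace_eq_span, span_image_inf_symPiece fun I => formProd_mem_symPiece α _]
  exact finrank_span_image_of_linearIndepOn
    ((linearIndepOn_formProd_passiveComplement α).mono fun I hI => hI.1.1)

theorem finrank_flatPiece (α : Fin n → Dual K V) (X : Set (Fin n)) (k : ℕ) :
    finrank K ↥(flatPiece α X k) =
      {I : Set (Fin n) | (linMatroid (K := K) α).Indep I ∧
        (linMatroid (K := K) α).closure I = X ∧
        (I ∪ extActive (linMatroid (K := K) α) I).ncard = k}.ncard := by
  have himage : {I : Set (Fin n) | (linMatroid (K := K) α).Indep I ∧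
      (linMatroid (K := K) α).closure I = X ∧
      (I ∪ extActive (linMatroid (K := K) α) I).ncard = k} =
      (fun I : Finset (Fin n) => (I : Set (Fin n))) ''
        {I : Finset (Fin n) | (LinearIndepOn K α (I : Set (Fin n)) ∧
          (linMatroid (K := K) α).closure I = X) ∧
          n - (passiveComplement (K := K) α Finset.univ I).card = k} := by
    ext I
    constructor
    · rintro ⟨h1, h2, h3⟩
      lift I to Finset (Fin n) using Set.toFinite I
      exact ⟨I, ⟨⟨h1, h2⟩, by rw [← ncard_union_extActive]; exact h3⟩, rfl⟩
    · rintro ⟨I, ⟨⟨h1, h2⟩, h3⟩, rfl⟩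
      exact ⟨h1, h2, by rw [← h3, ← ncard_union_extActive]⟩
  rw [himage, Set.ncard_image_of_injective _ Finset.coe_injective]
  have hcard (I : Finset (Fin n)) : (passiveComplement (K := K) α Finset.univ I).card ≤ n := by
    simpa using Finset.card_le_univ (passiveComplement (K := K) α Finset.univ I)
  by_cases hk : k ≤ n
  · have h : flatPiece α X k = flatSpace α X ⊓ symPiece K V (n - k) := if_pos hk
    rw [h, finrank_flatSpace_inf_symPiece]
    congr 1
    ext I
    refine and_congr_right fun _ => ?_
    have := hcard I
    omega
  · have h : flatPiece α X k = ⊥ := if_neg hk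
    rw [h, finrank_bot, eq_comm, Set.ncard_eq_zero, Set.eq_empty_iff_forall_notMem]
    rintro I ⟨-, h⟩
    omega

end FlatSpace

/-! ### The Tutte polynomial at x = 1 and the Hilbert series -/

section Tutte

variable {K V : Type*} [Field K] [AddCommGroup V] [Module K V] {n : ℕ}

/-- Binomial theorem over the subsets `S \ B` of the complement of `B ∪ P`. -/
theorem sum_pow_card_interval {ι R : Type*} [Fintype ι] [DecidableEq ι] [CommRing R] (u : R)
    {B P : Finset ι} (h : Disjoint B P) :
    ∑ S : Finset ι with B ⊆ S ∧ Disjoint S P, u ^ (S.card - B.card) =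
      (u + 1) ^ (Fintype.card ι - P.card - B.card) := by
  have hcard : (Pᶜ \ B).card = Fintype.card ι - P.card - B.card := by
    rw [Finset.card_sdiff_of_subset, Finset.card_compl]
    exact fun e he => Finset.mem_compl.2 (Finset.disjoint_left.1 h he)
  rw [← hcard, ← Finset.sum_pow_mul_eq_add_pow]
  refine Finset.sum_bij' (fun S _ => S \ B) (fun A _ => A ∪ B) ?_ ?_ ?_ ?_ ?_
  · intro S hS
    obtain ⟨h1, h2⟩ := (Finset.mem_filter.1 hS).2
    rw [Finset.mem_powerset]
    exact Finset.sdiff_subset_sdiff (fun e he => Finset.mem_compl.2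
      (Finset.disjoint_left.1 h2 he)) le_rfl
  · intro A hA
    rw [Finset.mem_powerset] at hA
    refine Finset.mem_filter.2 ⟨Finset.mem_univ _, Finset.subset_union_right, ?_⟩
    rw [Finset.disjoint_union_left]
    refine ⟨Finset.disjoint_left.2 fun e he => ?_, h⟩
    exact Finset.mem_compl.1 (Finset.mem_sdiff.1 (hA he)).1
  · intro S hS
    exact Finset.sdiff_union_of_subset (Finset.mem_filter.1 hS).2.1
  · intro A hA
    rw [Finset.mem_powerset] at hA
    exact Finset.union_sdiff_cancel_right
      (Finset.disjoint_left.2 fun e he => (Finset.mem_sdiff.1 (hA he)).2)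
  · intro S hS
    rw [Finset.card_sdiff_of_subset (Finset.mem_filter.1 hS).2.1, one_pow, mul_one]

open Classical in
/-- The bases of the matroid of a spanning family. -/
def linBases (K : Type*) {W ι : Type*} [Field K] [AddCommGroup W] [Module K W] [Fintype ι]
    (α : ι → W) : Finset (Finset ι) :=
  Finset.univ.filter fun B : Finset ι => LinearIndepOn K α (B : Set ι) ∧
    Submodule.span K (α '' (B : Set ι)) = ⊤

theorem mem_linBases {W ι : Type*} [AddCommGroup W] [Module K W] [Fintype ι] {α : ι → W}
    {B : Finset ι} : B ∈ linBases K α ↔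
      LinearIndepOn K α (B : Set ι) ∧ Submodule.span K (α '' (B : Set ι)) = ⊤ := by
  simp [linBases]

theorem aeval_tuttePoly_linMatroid {W R : Type*} [AddCommGroup W] [Module K W]
    [FiniteDimensional K W] [CommRing R] [Algebra ℤ R] {α : Fin n → W}
    (hα : Submodule.span K (Set.range α) = ⊤) (y : R) :
    MvPolynomial.aeval ![(1 : R), y] (tuttePoly (linMatroid (K := K) α)) =
      ∑ B ∈ linBases K α,
        y ^ (n - (passiveComplement (K := K) α Finset.univ B).card - finrank K W) := by
  classical
  have hrank : (linMatroid (K := K) α).eRank.toNat = finrank K W := by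
    rw [Matroid.eRank_def, linMatroid_ground, eRk_linMatroid_toNat, Set.image_univ, hα, finrank_top]
  have hcorank : MvPolynomial.aeval ![(1 : R), y] (tuttePoly (linMatroid (K := K) α)) =
      ∑ S ∈ Finset.univ.filter fun S : Finset (Fin n) =>
          Submodule.span K (α '' (S : Set (Fin n))) = ⊤,
        (y - 1) ^ (S.card - finrank K W) := by
    rw [tuttePoly, map_sum, Finset.sum_filter, Finset.sum_filter]
    refine Finset.sum_congr rfl fun S _ => ?_
    rw [if_pos (by exact Set.subset_univ _), hrank, eRk_linMatroid_toNat]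
    simp only [map_mul, map_pow, map_sub, MvPolynomial.aeval_X, map_one, Matrix.cons_val_zero,
      Matrix.cons_val_one, sub_self]
    -- At x = 1 a non-spanning set contributes a positive power of 0.
    split_ifs with hS
    · rw [hS, finrank_top, Nat.sub_self, pow_zero, one_mul]
    · have := Submodule.finrank_lt hS
      rw [zero_pow (by omega), zero_mul]
  rw [hcorank, ← Finset.sum_fiberwise_of_maps_to (g := lastBasis K α) (t := linBases K α)]
  · refine Finset.sum_congr rfl fun B hB => ?_
    obtain ⟨hind, hspan⟩ := mem_linBases.1 hB
    have hcard : B.card = finrank K W := by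
      rw [← Set.ncard_coe_finset, ← finrank_span_image_of_linearIndepOn hind, hspan, finrank_top]
    have hdisj : Disjoint B (passiveComplement (K := K) α Finset.univ B) :=
      Finset.disjoint_left.2 fun e he h => (mem_passiveComplement.1 h).2.1 he
    have hsum := sum_pow_card_interval (y - 1) hdisj
    rw [sub_add_cancel, Fintype.card_fin, hcard] at hsum
    rw [← hsum, Finset.filter_filter]
    refine Finset.sum_congr (Finset.filter_congr fun S _ => ?_) fun _ _ => rfl
    rw [← lastBasis_eq_iff hind]
    refine and_iff_right_of_imp fun h => ?_
    rw [← span_lastBasis, h, hspan]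
  · intro S hS
    refine mem_linBases.2 ⟨linearIndepOn_lastBasis α S, ?_⟩
    rw [span_lastBasis]
    exact (Finset.mem_filter.1 hS).2

theorem hilbertSeries_flatSpace_univ {α : Fin n → Dual K V}
    (hα : Submodule.span K (Set.range α) = ⊤) :
    hilbertSeries (flatSpace α Set.univ) =
      ∑ B ∈ linBases K α,
        PowerSeries.X ^ (passiveComplement (K := K) α Finset.univ B).card := by
  classical
  ext d
  rw [hilbertSeries, PowerSeries.coeff_mk, finrank_flatSpace_inf_symPiece, map_sum]
  simp only [PowerSeries.coeff_X_pow, closure_linMatroid_eq_univ_iff hα]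
  rw [Finset.sum_boole, ← Set.ncard_coe_finset]
  congr 2
  ext B
  simp [mem_linBases, eq_comm]

theorem coe_hilbertSeries_flatSpace_univ [FiniteDimensional K V] {α : Fin n → Dual K V}
    (hα : Submodule.span K (Set.range α) = ⊤) :
    ((hilbertSeries (flatSpace α Set.univ) : PowerSeries ℤ) : LaurentSeries ℤ) =
      HahnSeries.single ((n : ℤ) - (finrank K V : ℤ)) (1 : ℤ) *
        MvPolynomial.aeval ![(1 : LaurentSeries ℤ), HahnSeries.single (-1 : ℤ) (1 : ℤ)]
          (tuttePoly (linMatroid (K := K) α)) := by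
  classical
  rw [aeval_tuttePoly_linMatroid hα, hilbertSeries_flatSpace_univ hα, map_sum, Finset.mul_sum]
  refine Finset.sum_congr rfl fun B hB => ?_
  obtain ⟨hind, hspan⟩ := mem_linBases.1 hB
  have hcard : B.card = finrank K V := by
    rw [← Set.ncard_coe_finset, ← finrank_span_image_of_linearIndepOn hind, hspan, finrank_top,
      Subspace.dual_finrank_eq]
  -- This bound makes the truncated subtraction in the exponent of `y` agree with subtraction in ℤ.
  have hle : B.card + (passiveComplement (K := K) α Finset.univ B).card ≤ n := by
    rw [← Finset.card_union_of_disjoint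
      (Finset.disjoint_left.2 fun e he h => (mem_passiveComplement.1 h).2.1 he)]
    simpa using Finset.card_le_univ (B ∪ passiveComplement (K := K) α Finset.univ B)
  rw [HahnSeries.ofPowerSeries_X_pow, HahnSeries.single_pow, HahnSeries.single_mul_single, one_pow,
    one_mul, Subspace.dual_finrank_eq]
  refine congrArg (fun i : ℤ => HahnSeries.single i (1 : ℤ)) ?_
  rw [nsmul_eq_mul]
  omega

end Tutte

end

theorem mainTheorem5 {K V : Type*} [Field K] [AddCommGroup V] [Module K V]
    [FiniteDimensional K V] {n : ℕ} (α : Fin n → Module.Dual K V)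
    (hα : Submodule.span K (Set.range α) = ⊤) :
    flatSpace α Set.univ = Submodule.span K
        {p | ∃ S : Finset (Fin n),
          spanRank α (S : Set (Fin n))ᶜ = Module.finrank K V ∧ p = formProd α S} ∧
    ((hilbertSeries (flatSpace α Set.univ) : PowerSeries ℤ) : LaurentSeries ℤ) =
      HahnSeries.single ((n : ℤ) - (Module.finrank K V : ℤ)) (1 : ℤ) *
        MvPolynomial.aeval ![(1 : LaurentSeries ℤ), HahnSeries.single (-1 : ℤ) (1 : ℤ)]
          (tuttePoly (linMatroid (K := K) α)) ∧
    ∀ X : Set (Fin n), (linMatroid (K := K) α).IsFlat X → ∀ k : ℕ,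
      Module.finrank K ↥(flatPiece α X k) =
        {I : Set (Fin n) | (linMatroid (K := K) α).Indep I ∧
          (linMatroid (K := K) α).closure I = X ∧
          (I ∪ extActive (linMatroid (K := K) α) I).ncard = k}.ncard := by
  refine ⟨?_, coe_hilbertSeries_flatSpace_univ hα, fun X _ k => finrank_flatPiece α X k⟩
  have hiff (S : Finset (Fin n)) :
      (linMatroid (K := K) α).closure (S : Set (Fin n))ᶜ = Set.univ ↔
        spanRank α (S : Set (Fin n))ᶜ = Module.finrank K V := by
    rw [closure_linMatroid_eq_univ_iff hα, spanRank, ← Subspace.dual_finrank_eq]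
    exact ⟨fun h => by rw [h, finrank_top], Submodule.eq_top_of_finrank_eq⟩
  simp only [flatSpace, hiff]
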